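/- Let $J$ be an infinite set, let $J_{\rm fin}$ be the family of its finite subsets, and let $\varphi: J_{\rm fin}\to\mathbb{R}$ satisfy $\varphi(\emptyset)=0$. Call $\varphi$ strongly submodular if for every $n\ge 1$ and all $A_0,A_1,\dots,A_n\in J_{\rm fin}$, $$\sum_{K\subseteq\{1,\dots,n\}}(-1)^{|K|}\,\varphi\Big(A_0\cup\bigcup_{i\in K}A_i\Big)\le 0 .$$ For $A,B\in J_{\rm fin}$ let $$\overline{\varphi}(A,B)=\sum_{X\subseteq B}(-1)^{|X|}\varphi(A\cup X).$$ Let $I=J^{\mathbb{N}}$ be the set of all sequences of elements of $J$. For $A\in J_{\rm fin}$ let $R(A)\subseteq I$ be the set of sequences in which at least one element of $A$ appears. For $A,B\in J_{\rm fin}$ let $H(A,B)\subseteq I$ be the set of sequences in which every element of $B$ and no element of $A$ appears, and let $\mathcal{C}$ be the sigma-algebra on $I$ generated by the sets $H(A,B)$, $A,B\in J_{\rm fin}$. Then the following are equivalent: (a) $\varphi$ is strongly submodular; (b) $\overline{\varphi}(A,B)\le 0$ for all $A,B\in J_{\rm fin}$ with $B\ne\emptyset$; (c) there is a (nonnegative,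 countably additive, possibly infinite) measure $\alpha$ on $(I,\mathcal{C})$ such that $\alpha(R(A))=\varphi(A)$ for every $A\in J_{\rm fin}$. If $\varphi$ is bounded from above, then the same equivalence holds with $\alpha$ in (c) required to be a finite measure. -/

import Mathlib

open MeasureTheory

/-- A setfunction `φ` on the finite subsets of `J` is strongly submodular: for all `n ≥ 1` and all
finite sets `A₀, A 1, …, A n`, one has `∑_{K ⊆ [n]} (-1)^|K| φ (A₀ ∪ ⋃_{i ∈ K} A i) ≤ 0`. -/
def StronglySubmodular {J : Type*} [DecidableEq J] (φ : Finset J → ℝ) : Prop :=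
  ∀ n : ℕ, 1 ≤ n → ∀ (A₀ : Finset J) (A : Fin n → Finset J),
    ∑ K : Finset (Fin n), (-1 : ℝ) ^ K.card * φ (A₀ ∪ K.biUnion A) ≤ 0

/-- The sum `φ̄(A, B) = ∑_{X ⊆ B} (-1)^|X| φ (A ∪ X)`. -/
def mobiusSum {J : Type*} [DecidableEq J] (φ : Finset J → ℝ) (A B : Finset J) : ℝ :=
  ∑ X ∈ B.powerset, (-1 : ℝ) ^ X.card * φ (A ∪ X)

/-- The relation `R` between points of `J` and sequences in `J`: the point `y` appears in the
sequence `x`. -/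
def appearsIn (J : Type*) : SetRel J (ℕ → J) :=
  {p | ∃ n, p.2 n = p.1}

/-- `R(A)`: the set of sequences in which at least one point of `A` appears. -/
def hitSet {J : Type*} (A : Finset J) : Set (ℕ → J) :=
  (appearsIn J).image (A : Set J)

/-- `H(A, B)`: the set of sequences in which all points of `B` and no point of `A` appear. -/
def missHitSet {J : Type*} (A B : Finset J) : Set (ℕ → J) :=
  {x | ∀ y ∈ B, (y, x) ∈ appearsIn J} \ hitSet A

/-- The sigma-algebra on the space of sequences generated by the sets `H(A, B)`, where `A` and `B`
are finite subsets of `J`. -/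
@[reducible]
def sequenceSigmaAlgebra (J : Type*) : MeasurableSpace (ℕ → J) :=
  MeasurableSpace.generateFrom {S | ∃ A B : Finset J, S = missHitSet A B}

theorem mem_hitSet {J : Type*} {A : Finset J} {x : ℕ → J} :
    x ∈ hitSet A ↔ ∃ n, x n ∈ A := by
  simp only [hitSet, SetRel.image, appearsIn, Set.mem_ofPred_eq, Finset.mem_coe]
  constructor
  · rintro ⟨y, hy, n, rfl⟩
    exact ⟨n, hy⟩
  · rintro ⟨n, hn⟩
    exact ⟨x n, hn, n, rfl⟩

theorem measurableSet_hitSet {J : Type*} (A : Finset J) :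
    MeasurableSet[sequenceSigmaAlgebra J] (hitSet A) := by
  have h : MeasurableSet[sequenceSigmaAlgebra J] (missHitSet A ∅) :=
    MeasurableSpace.measurableSet_generateFrom ⟨A, ∅, rfl⟩
  have h2 : hitSet A = (missHitSet A ∅)ᶜ := by
    ext x
    simp [missHitSet]
  rw [h2]
  exact h.compl

/-- The (countably additive, nonnegative, possibly infinite) measure `α` represents `φ`: each
`α(R(A))` is finite and equals `φ(A)`. -/
def RepresentsSetfunction {J : Type*} (α : @Measure (ℕ → J) (sequenceSigmaAlgebra J))
    (φ : Finset J → ℝ) : Prop :=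
  ∀ A : Finset J, α (hitSet A) ≠ ⊤ ∧ (α (hitSet A)).toReal = φ A

/-!
The sets `H(A, B)` with `B ≠ ∅` form a semiring that generates the sigma-algebra, and `R(A)` is a
finite disjoint union of such sets. A measure `α` with `α (R(A)) = φ(A)` must satisfy
`α (H(A, B)) = -φ̄(A, B)`, by inclusion-exclusion.

If all `φ̄(A, B)` with `B ≠ ∅` are nonpositive, this formula defines a content on the semiring.
Additivity comes from discrete measures: for a finite set `F`, put the mass `-φ̄(F \ T, T)` on one
sequence with set of terms `T`, for each nonempty `T ⊆ F`. By the recursion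
`φ̄(A, B) = φ̄(A ∪ {y}, B) + φ̄(A, B ∪ {y})` for `y ∉ B` (`mobiusSum_insert`), this measure has the
right value on `H(A, B)` as soon as `A ∪ B ⊆ F` (`finApprox_missHitSet`). Countable subadditivity
comes from compactness of `{0, 1}^J`: a set `H(A, B)` with `B ≠ ∅` that is covered by countably many
sets `H(A i, B i)` is covered by finitely many of them (`exists_finite_cover`). Carathéodory's
theorem then gives the measure.

Conversely, the sum in the definition of strong submodularity is minus the measure of the set of
sequences that miss `A₀` and hit every `A i`. For singletons `A i` it is `φ̄(A₀, B)`.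

When `φ` is bounded, a representing measure is restricted to a countable union of sets `R(B n)`
along which `φ` tends to its supremum. This makes it finite, and takes away only a null set from
each `R(A)`.
-/

section Hypersequences

-- No sigma-algebra on `J` is given, so this does not compete with the product sigma-algebra.
attribute [local instance] sequenceSigmaAlgebra

variable {J : Type*}

/-! ### Sets of sequences -/

theorem mem_missHitSet {A B : Finset J} {x : ℕ → J} :
    x ∈ missHitSet A B ↔ (∀ y ∈ B, y ∈ Set.range x) ∧ ∀ y ∈ A, y ∉ Set.range x := by
  rw [missHitSet, Set.mem_sdiff, mem_hitSet]
  refine and_congr Iff.rfl ⟨?_, ?_⟩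
  · rintro h y hy ⟨n, rfl⟩
    exact h ⟨n, hy⟩
  · rintro h ⟨n, hn⟩
    exact h _ hn ⟨n, rfl⟩

theorem hitSet_mono {A B : Finset J} (h : A ⊆ B) : hitSet A ⊆ hitSet B := fun x hx => by
  obtain ⟨n, hn⟩ := mem_hitSet.1 hx
  exact mem_hitSet.2 ⟨n, h hn⟩

theorem measurableSet_missHitSet (A B : Finset J) : MeasurableSet (missHitSet A B) :=
  MeasurableSpace.measurableSet_generateFrom ⟨A, B, rfl⟩

/-- The sets `H(A, B)` with `B` nonempty. -/
def hitCylinders (J : Type*) : Set (Set (ℕ → J)) :=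
  {S | ∃ A B : Finset J, B.Nonempty ∧ S = missHitSet A B}

theorem measurableSet_of_mem_hitCylinders {S : Set (ℕ → J)} (hS : S ∈ hitCylinders J) :
    MeasurableSet S := by
  obtain ⟨A, B, -, rfl⟩ := hS
  exact measurableSet_missHitSet A B

theorem sequenceSigmaAlgebra_eq_generateFrom :
    sequenceSigmaAlgebra J = MeasurableSpace.generateFrom (hitCylinders J) := by
  refine le_antisymm (MeasurableSpace.generateFrom_le ?_)
    (MeasurableSpace.generateFrom_mono ?_)
  · rintro _ ⟨A, B, rfl⟩
    have hsingle : ∀ y : J, MeasurableSet[MeasurableSpace.generateFrom (hitCylinders J)]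
        {x : ℕ → J | y ∈ Set.range x} := fun y =>
      MeasurableSpace.measurableSet_generateFrom ⟨∅, {y}, Finset.singleton_nonempty y, by
        ext x
        simp [mem_missHitSet]⟩
    have heq : missHitSet A B = (⋂ y ∈ B, {x : ℕ → J | y ∈ Set.range x}) ∩
        ⋂ y ∈ A, {x : ℕ → J | y ∈ Set.range x}ᶜ := by
      ext x
      simp only [mem_missHitSet, Set.mem_inter_iff, Set.mem_iInter, Set.mem_compl_iff,
        Set.mem_ofPred_eq]
    rw [heq]
    exact MeasurableSet.inter (Finset.measurableSet_biInter B fun y _ => hsingle y)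
      (Finset.measurableSet_biInter A fun y _ => (hsingle y).compl)
  · rintro _ ⟨A, B, -, rfl⟩
    exact ⟨A, B, rfl⟩

/-- A sequence whose set of terms is `T`; a junk value when `T` is empty. -/
noncomputable def enumSeq [Nonempty J] (T : Finset J) : ℕ → J :=
  Classical.epsilon fun x => Set.range x = (T : Set J)

theorem range_enumSeq [Nonempty J] {T : Finset J} (hT : T.Nonempty) :
    Set.range (enumSeq T) = (T : Set J) := by
  obtain ⟨x, hx⟩ := T.countable_toSet.exists_eq_range (by simpa using hT)
  exact Classical.epsilon_spec (p := fun x => Set.range x = (T : Set J)) ⟨x, hx.symm⟩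

theorem RepresentsSetfunction.apply_eq {φ : Finset J → ℝ} {α : Measure (ℕ → J)}
    (h : RepresentsSetfunction α φ) (A : Finset J) : α (hitSet A) = ENNReal.ofReal (φ A) := by
  rw [← (h A).2, ENNReal.ofReal_toReal (h A).1]

variable [DecidableEq J]

/-! ### The alternating sums -/

theorem mobiusSum_insert (φ : Finset J → ℝ) (A : Finset J) {B : Finset J} {y : J} (hy : y ∉ B) :
    mobiusSum φ A (insert y B) = mobiusSum φ A B - mobiusSum φ (insert y A) B := by
  unfold mobiusSum
  rw [Finset.sum_powerset_insert hy, sub_eq_add_neg, ← Finset.sum_neg_distrib]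
  congr 1
  refine Finset.sum_congr rfl fun X hX => ?_
  rw [Finset.card_insert_of_notMem fun h => hy (Finset.mem_powerset.1 hX h), Finset.union_insert,
    Finset.insert_union]
  ring

theorem mobiusSum_eq_zero (φ : Finset J → ℝ) {A B : Finset J} (h : ¬ Disjoint A B) :
    mobiusSum φ A B = 0 := by
  obtain ⟨y, hA, hB⟩ := Finset.not_disjoint_iff.1 h
  rw [← Finset.insert_erase hB, mobiusSum_insert φ A (Finset.notMem_erase y B),
    Finset.insert_eq_of_mem hA, sub_self]

theorem mobiusSum_singleton (φ : Finset J → ℝ) (A : Finset J) (y : J) :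
    mobiusSum φ A {y} = φ A - φ (insert y A) := by
  rw [← insert_empty_eq, mobiusSum_insert φ A (Finset.notMem_empty y)]
  simp [mobiusSum]

/-- Splitting `H(A, B)` according to which points of `D` appear leaves the total alternating sum
unchanged. -/
theorem sum_mobiusSum_split (φ : Finset J → ℝ) (D : Finset J) (A B : Finset J)
    (hD : Disjoint D B) :
    ∑ X ∈ D.powerset, mobiusSum φ (A ∪ (D \ X)) (B ∪ X) = mobiusSum φ A B := by
  induction D using Finset.induction_on generalizing A B with
  | empty => simp
  | insert y D hy ih =>
    rw [Finset.disjoint_insert_left] at hD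
    rw [Finset.sum_powerset_insert hy]
    have h1 : ∑ X ∈ D.powerset, mobiusSum φ (A ∪ (insert y D \ X)) (B ∪ X)
        = mobiusSum φ (insert y A) B := by
      rw [← ih (insert y A) B hD.2]
      refine Finset.sum_congr rfl fun X hX => ?_
      rw [Finset.insert_sdiff_of_notMem _ fun h => hy (Finset.mem_powerset.1 hX h),
        Finset.union_insert, Finset.insert_union]
    have h2 : ∑ X ∈ D.powerset, mobiusSum φ (A ∪ (insert y D \ insert y X)) (B ∪ insert y X)
        = mobiusSum φ A (insert y B) := by
      rw [← ih A (insert y B) (Finset.disjoint_insert_right.2 ⟨hy, hD.2⟩)]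
      refine Finset.sum_congr rfl fun X hX => ?_
      rw [Finset.insert_sdiff_insert, Finset.sdiff_insert_of_notMem hy, Finset.union_insert,
        Finset.insert_union]
    rw [h1, h2, mobiusSum_insert φ A hD.1]
    ring

theorem StronglySubmodular.mobiusSum_nonpos {φ : Finset J → ℝ} (h : StronglySubmodular φ)
    (A : Finset J) {B : Finset J} (hB : B ≠ ∅) : mobiusSum φ A B ≤ 0 := by
  let e : Fin B.card ↪ J := (B.equivFin.symm.toEmbedding).trans (Function.Embedding.subtype _)
  have hmap : Finset.univ.map e = B := by
    ext y
    simp only [Finset.mem_map, Finset.mem_univ, true_and, e]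
    constructor
    · rintro ⟨i, rfl⟩
      exact (B.equivFin.symm i).2
    · intro hy
      exact ⟨B.equivFin ⟨y, hy⟩, by simp⟩
  refine le_of_eq_of_le ?_ (h B.card (Finset.card_pos.2 (Finset.nonempty_iff_ne_empty.2 hB)) A
    fun i => {e i})
  have hpow : B.powerset = Finset.univ.map (Finset.mapEmbedding e).toEmbedding := by
    conv_lhs => rw [← hmap]
    ext X
    rw [Finset.mem_powerset, Finset.subset_map_iff]
    simp [eq_comm]
  rw [mobiusSum, hpow, Finset.sum_map]
  refine Finset.sum_congr rfl fun K _ => ?_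
  rw [RelEmbedding.coe_toEmbedding, Finset.mapEmbedding_apply, Finset.card_map,
    Finset.map_eq_image, Finset.biUnion_singleton]

/-! ### Discrete approximations -/

/-- The discrete measure that gives the sets `H(F \ T, T)`, where `∅ ≠ T ⊆ F`, the mass
`-φ̄(F \ T, T)` prescribed by `φ`, and has no mass outside `R(F)`. -/
noncomputable def finApprox [Nonempty J] (φ : Finset J → ℝ) (F : Finset J) : Measure (ℕ → J) :=
  ∑ T ∈ F.powerset with T.Nonempty,
    ENNReal.ofReal (-mobiusSum φ (F \ T) T) • Measure.dirac (enumSeq T)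

theorem finApprox_missHitSet [Nonempty J] {φ : Finset J → ℝ}
    (hφ : ∀ A B : Finset J, B ≠ ∅ → mobiusSum φ A B ≤ 0) {A B F : Finset J} (hB : B.Nonempty)
    (hF : A ∪ B ⊆ F) :
    finApprox φ F (missHitSet A B) = ENNReal.ofReal (-mobiusSum φ A B) := by
  have hmem : ∀ T : Finset J, T.Nonempty →
      (enumSeq T ∈ missHitSet A B ↔ B ⊆ T ∧ Disjoint A T) := by
    intro T hT
    rw [mem_missHitSet, range_enumSeq hT, Finset.disjoint_left]
    rfl
  have hsum : finApprox φ F (missHitSet A B) =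
      ∑ T ∈ F.powerset with B ⊆ T ∧ Disjoint A T,
        ENNReal.ofReal (-mobiusSum φ (F \ T) T) := by
    have hfilter : (F.powerset.filter fun T => B ⊆ T ∧ Disjoint A T) =
        (F.powerset.filter fun T => T.Nonempty).filter fun T => B ⊆ T ∧ Disjoint A T := by
      ext T
      simp only [Finset.mem_filter, and_assoc]
      exact and_congr_right fun _ => ⟨fun h => ⟨hB.mono h.1, h⟩, fun h => h.2⟩
    rw [finApprox, Measure.finsetSum_apply, hfilter,
      Finset.sum_filter (s := F.powerset.filter fun T => T.Nonempty)]
    refine Finset.sum_congr rfl fun T hT => ?_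
    rw [Measure.smul_apply, Measure.dirac_apply' _ (measurableSet_missHitSet A B), Set.indicator,
      smul_eq_mul]
    simp [hmem T (Finset.mem_filter.1 hT).2]
  rw [hsum]
  by_cases hAB : Disjoint A B
  · have hD : Disjoint (F \ (A ∪ B)) B :=
      Finset.disjoint_of_subset_right Finset.subset_union_right Finset.sdiff_disjoint
    rw [← sum_mobiusSum_split φ (F \ (A ∪ B)) A B hD, ← Finset.sum_neg_distrib,
      ENNReal.ofReal_sum_of_nonneg]
    · rw [Finset.disjoint_left] at hAB
      refine Finset.sum_nbij' (fun T => T \ B) (fun X => B ∪ X) ?_ ?_ ?_ ?_ ?_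
      · intro T hT
        simp only [Finset.mem_filter, Finset.mem_powerset, Finset.disjoint_left] at hT ⊢
        clear hsum hmem hφ
        grind
      · intro X hX
        simp only [Finset.mem_filter, Finset.mem_powerset, Finset.disjoint_left] at hX ⊢
        clear hsum hmem hφ
        grind
      · intro T hT
        simp only [Finset.mem_filter] at hT
        exact Finset.union_sdiff_of_subset hT.2.1
      · intro X hX
        rw [Finset.mem_powerset] at hX
        clear hsum hmem hφ
        grind
      · intro T hT
        simp only [Finset.mem_filter, Finset.mem_powerset, Finset.disjoint_left] at hT
        rw [Finset.union_sdiff_of_subset hT.2.1]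
        congr 3
        clear hsum hmem hφ
        grind
    · intro X _
      exact neg_nonneg.2 (hφ _ _ (hB.mono Finset.subset_union_left).ne_empty)
  · rw [mobiusSum_eq_zero φ hAB, neg_zero, ENNReal.ofReal_zero]
    refine Finset.sum_eq_zero fun T hT => absurd ?_ hAB
    exact Finset.disjoint_of_subset_right (Finset.mem_filter.1 hT).2.1 (Finset.mem_filter.1 hT).2.2

/-! ### Semiring property and compactness -/

theorem isSetSemiring_hitCylinders [Nonempty J] : IsSetSemiring (hitCylinders J) where
  empty_mem := by
    obtain ⟨y⟩ := ‹Nonempty J›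
    refine ⟨{y}, {y}, Finset.singleton_nonempty y, ?_⟩
    ext x
    simp [mem_missHitSet]
  inter_mem := by
    rintro _ ⟨A, B, hB, rfl⟩ _ ⟨A', B', -, rfl⟩
    refine ⟨A ∪ A', B ∪ B', hB.mono Finset.subset_union_left, ?_⟩
    ext x
    simp only [Set.mem_inter_iff, mem_missHitSet, Finset.mem_union]
    grind
  sdiff_eq_sUnion' := by
    classical
    rintro _ ⟨A, B, hB, rfl⟩ _ ⟨A', B', -, rfl⟩
    -- Split `H(A, B)` by the set `X` of those points of `A' ∪ B'` that appear.
    let g : Finset J → Set (ℕ → J) := fun X => missHitSet (A ∪ ((A' ∪ B') \ X)) (B ∪ X)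
    refine ⟨((A' ∪ B').powerset.filter fun X => ¬ (B' ⊆ X ∧ Disjoint A' X)).image g, ?_, ?_, ?_⟩
    · intro S hS
      obtain ⟨X, -, rfl⟩ := Finset.mem_image.1 (Finset.mem_coe.1 hS)
      exact ⟨_, _, hB.mono Finset.subset_union_left, rfl⟩
    · intro S hS S' hS' hne
      obtain ⟨X, hX, rfl⟩ := Finset.mem_image.1 (Finset.mem_coe.1 hS)
      obtain ⟨X', hX', rfl⟩ := Finset.mem_image.1 (Finset.mem_coe.1 hS')
      refine Set.disjoint_left.2 fun x hx hx' => hne (congrArg g ?_)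
      simp only [id, g, mem_missHitSet, Finset.mem_union, Finset.mem_sdiff] at hx hx'
      simp only [Finset.mem_filter, Finset.mem_powerset] at hX hX'
      refine Finset.Subset.antisymm (fun y hy => ?_) fun y hy => ?_
      · by_contra h
        exact hx'.2 y (Or.inr ⟨Finset.mem_union.1 (hX.1 hy), h⟩) (hx.1 y (Or.inr hy))
      · by_contra h
        exact hx.2 y (Or.inr ⟨Finset.mem_union.1 (hX'.1 hy), h⟩) (hx'.1 y (Or.inr hy))
    · ext x
      simp only [Set.mem_sdiff, Set.mem_sUnion, Finset.coe_image, Set.mem_image, Finset.mem_coe,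
        Finset.mem_filter, Finset.mem_powerset]
      constructor
      · rintro ⟨hx, hx'⟩
        refine ⟨_, ⟨(A' ∪ B').filter fun y => y ∈ Set.range x, ⟨Finset.filter_subset _ _, ?_⟩,
          rfl⟩, ?_⟩
        · rintro ⟨h1, h2⟩
          refine hx' (mem_missHitSet.2 ⟨fun y hy => (Finset.mem_filter.1 (h1 hy)).2,
            fun y hy hyx => Finset.disjoint_left.1 h2 hy
              (Finset.mem_filter.2 ⟨Finset.mem_union_left _ hy, hyx⟩)⟩)
        · rw [mem_missHitSet] at hx
          refine mem_missHitSet.2 ⟨fun y hy => ?_, fun y hy => ?_⟩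
          · rcases Finset.mem_union.1 hy with h | h
            · exact hx.1 y h
            · exact (Finset.mem_filter.1 h).2
          · rcases Finset.mem_union.1 hy with h | h
            · exact hx.2 y h
            · rw [Finset.mem_sdiff, Finset.mem_filter] at h
              exact fun hyx => h.2 ⟨h.1, hyx⟩
      · rintro ⟨_, ⟨X, ⟨hX, hX'⟩, rfl⟩, hx⟩
        simp only [g, mem_missHitSet, Finset.mem_union, Finset.mem_sdiff] at hx ⊢
        refine ⟨⟨fun y hy => hx.1 y (Or.inl hy), fun y hy => hx.2 y (Or.inl hy)⟩, fun h => hX' ?_⟩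
        refine ⟨fun y hy => ?_, Finset.disjoint_left.2 fun y hy hyX =>
          h.2 y hy (hx.1 y (Or.inr hyX))⟩
        by_contra hyX
        exact hx.2 y (Or.inr ⟨Or.inr hy, hyX⟩) (h.1 y hy)

/-- Compactness of `{0, 1}^J`, transferred to sequences: a point of `{0, 1}^J` restricted to the
countably many coordinates that matter is the indicator of a countable set, which is nonempty
because `B` is, and so is the set of terms of a sequence. -/
theorem exists_finite_cover {A B : Finset J} (hB : B.Nonempty) (A' B' : ℕ → Finset J)
    (h : missHitSet A B ⊆ ⋃ i, missHitSet (A' i) (B' i)) :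
    ∃ t : Finset ℕ, missHitSet A B ⊆ ⋃ i ∈ t, missHitSet (A' i) (B' i) := by
  classical
  let cyl : Finset J → Finset J → Set (J → Bool) := fun A B =>
    (⋂ y ∈ B, {s | s y = true}) ∩ ⋂ y ∈ A, {s | s y = false}
  have mem_cyl : ∀ {A B s}, s ∈ cyl A B ↔ (∀ y ∈ B, s y = true) ∧ ∀ y ∈ A, s y = false := by
    intro A B s
    simp only [cyl, Set.mem_inter_iff, Set.mem_iInter, Set.mem_ofPred_eq]
  have hclopen : ∀ A B, IsClopen (cyl A B) := by
    intro A B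
    have : ∀ (y : J) (b : Bool), IsClopen {s : J → Bool | s y = b} := fun y b =>
      (isClopen_discrete {b}).preimage (continuous_apply y)
    exact (isClopen_biInter_finset fun y _ => this y true).inter
      (isClopen_biInter_finset fun y _ => this y false)
  have hcover : cyl A B ⊆ ⋃ i, cyl (A' i) (B' i) := by
    intro s hs
    rw [mem_cyl] at hs
    let c : Set J := (A ∪ B : Finset J) ∪ ⋃ i, ((A' i ∪ B' i : Finset J) : Set J)
    have hc : c.Countable := (Finset.countable_toSet _).union
      (Set.countable_iUnion fun i => Finset.countable_toSet _)
    obtain ⟨x, hx⟩ := (hc.mono (Set.inter_subset_left (t := {y | s y = true}))).exists_eq_range (by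
      obtain ⟨y, hy⟩ := hB
      exact ⟨y, Or.inl (Finset.mem_coe.2 (Finset.mem_union_right _ hy)), hs.1 y hy⟩)
    have hxm : x ∈ missHitSet A B := by
      rw [mem_missHitSet, ← hx]
      refine ⟨fun y hy => ⟨Or.inl (Finset.mem_coe.2 (Finset.mem_union_right _ hy)), hs.1 y hy⟩,
        fun y hy hy' => ?_⟩
      have h1 : s y = true := hy'.2
      simp [hs.2 y hy] at h1
    obtain ⟨i, hi⟩ := Set.mem_iUnion.1 (h hxm)
    rw [mem_missHitSet, ← hx] at hi
    refine Set.mem_iUnion.2 ⟨i, mem_cyl.2 ⟨fun y hy => (hi.1 y hy).2, fun y hy => ?_⟩⟩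
    by_contra hne
    exact hi.2 y hy ⟨Or.inr (Set.mem_iUnion.2 ⟨i, Finset.mem_coe.2 (Finset.mem_union_left _ hy)⟩),
      by simpa using hne⟩
  obtain ⟨t, ht⟩ := (hclopen A B).isClosed.isCompact.elim_finite_subcover
    (fun i => cyl (A' i) (B' i)) (fun i => (hclopen _ _).isOpen) hcover
  refine ⟨t, fun x hx => ?_⟩
  have mem_iff : ∀ A B : Finset J, (fun y => decide (y ∈ Set.range x)) ∈ cyl A B ↔
      x ∈ missHitSet A B := by
    intro A B
    rw [mem_cyl, mem_missHitSet]
    simp only [decide_eq_true_eq, decide_eq_false_iff_not]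
  have hx' := ht ((mem_iff A B).2 hx)
  simp only [Set.mem_iUnion] at hx' ⊢
  obtain ⟨i, hi, hxi⟩ := hx'
  exact ⟨i, hi, (mem_iff _ _).1 hxi⟩

/-! ### The representing measure -/

theorem eventually_finApprox_eq [Nonempty J] {φ : Finset J → ℝ}
    (hφ : ∀ A B : Finset J, B ≠ ∅ → mobiusSum φ A B ≤ 0) {S : Set (ℕ → J)}
    (hS : S ∈ hitCylinders J) :
    ∀ᶠ F in Filter.atTop,
      finApprox φ F S = Filter.limsup (fun F => finApprox φ F S) Filter.atTop := by
  obtain ⟨A, B, hB, rfl⟩ := hS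
  have h : ∀ᶠ F in Filter.atTop,
      finApprox φ F (missHitSet A B) = ENNReal.ofReal (-mobiusSum φ A B) :=
    (Filter.eventually_ge_atTop (A ∪ B)).mono fun F hF => finApprox_missHitSet hφ hB hF
  rw [Filter.limsup_congr h, Filter.limsup_const]
  exact h

/-- The content `H(A, B) ↦ -φ̄(A, B)`, written as the eventual value of the discrete
approximations. In this form it is visibly independent of the choice of `A` and `B`, and inherits
additivity. -/
noncomputable def limitContent [Nonempty J] {φ : Finset J → ℝ}
    (hφ : ∀ A B : Finset J, B ≠ ∅ → mobiusSum φ A B ≤ 0) :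
    AddContent ENNReal (hitCylinders J) where
  toFun S := Filter.limsup (fun F => finApprox φ F S) Filter.atTop
  empty' := by simp
  sUnion' I hI hdisj hmem := by
    obtain ⟨F, hF, hF'⟩ := ((eventually_finApprox_eq hφ hmem).and
      ((Filter.eventually_all_finset I).2 fun S hS => eventually_finApprox_eq hφ (hI hS))).exists
    rw [← hF, Set.sUnion_eq_biUnion, ← Finset.sum_congr rfl hF']
    exact measure_biUnion_finset hdisj fun S hS => measurableSet_of_mem_hitCylinders (hI hS)

theorem limitContent_missHitSet [Nonempty J] {φ : Finset J → ℝ}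
    (hφ : ∀ A B : Finset J, B ≠ ∅ → mobiusSum φ A B ≤ 0) (A : Finset J) {B : Finset J}
    (hB : B.Nonempty) :
    limitContent hφ (missHitSet A B) = ENNReal.ofReal (-mobiusSum φ A B) := by
  obtain ⟨F, hF, hF'⟩ := ((eventually_finApprox_eq hφ ⟨A, B, hB, rfl⟩).and
    (Filter.eventually_ge_atTop (A ∪ B))).exists
  exact hF.symm.trans (finApprox_missHitSet hφ hB hF')

theorem isSigmaSubadditive_limitContent [Nonempty J] {φ : Finset J → ℝ}
    (hφ : ∀ A B : Finset J, B ≠ ∅ → mobiusSum φ A B ≤ 0) :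
    (limitContent hφ).IsSigmaSubadditive := by
  intro f hf hU
  obtain ⟨A, B, hB, hAB⟩ := id hU
  choose A' B' hB' hf' using id hf
  obtain ⟨t, ht⟩ := exists_finite_cover hB A' B' (by
    rw [← hAB]
    exact Set.iUnion_mono fun i => (hf' i).le)
  obtain ⟨F, hF, hF'⟩ := ((eventually_finApprox_eq hφ hU).and
    ((Filter.eventually_all_finset t).2 fun i _ => eventually_finApprox_eq hφ (hf i))).exists
  calc limitContent hφ (⋃ i, f i) = finApprox φ F (⋃ i, f i) := hF.symm
    _ ≤ finApprox φ F (⋃ i ∈ t, f i) := by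
        refine measure_mono ?_
        simp only [← hf'] at ht
        rwa [hAB]
    _ ≤ ∑ i ∈ t, finApprox φ F (f i) := measure_biUnion_finset_le t f
    _ = ∑ i ∈ t, limitContent hφ (f i) := Finset.sum_congr rfl hF'
    _ ≤ ∑' i, limitContent hφ (f i) := ENNReal.sum_le_tsum t

theorem exists_measure_missHitSet [Nonempty J] {φ : Finset J → ℝ}
    (hφ : ∀ A B : Finset J, B ≠ ∅ → mobiusSum φ A B ≤ 0) :
    ∃ α : Measure (ℕ → J), ∀ A B : Finset J, B.Nonempty →
      α (missHitSet A B) = ENNReal.ofReal (-mobiusSum φ A B) := by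
  refine ⟨(limitContent hφ).measure isSetSemiring_hitCylinders
    sequenceSigmaAlgebra_eq_generateFrom.le (isSigmaSubadditive_limitContent hφ),
    fun A B hB => ?_⟩
  rw [AddContent.measure_eq _ _ sequenceSigmaAlgebra_eq_generateFrom _ ⟨A, B, hB, rfl⟩,
    limitContent_missHitSet hφ A hB]

theorem hitSet_insert (y : J) (A : Finset J) :
    hitSet (insert y A) = hitSet A ∪ missHitSet A {y} := by
  ext x
  simp only [Set.mem_union, mem_hitSet, mem_missHitSet, Finset.mem_insert, Finset.mem_singleton,
    forall_eq, Set.mem_range]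
  grind

theorem exists_representsSetfunction [Nonempty J] {φ : Finset J → ℝ} (h0 : φ ∅ = 0)
    (hφ : ∀ A B : Finset J, B ≠ ∅ → mobiusSum φ A B ≤ 0) :
    ∃ α : Measure (ℕ → J), RepresentsSetfunction α φ := by
  obtain ⟨α, hα⟩ := exists_measure_missHitSet hφ
  refine ⟨α, fun A => ?_⟩
  have key : 0 ≤ φ A ∧ α (hitSet A) = ENNReal.ofReal (φ A) := by
    induction A using Finset.induction_on with
    | empty =>
      have : hitSet (∅ : Finset J) = ∅ := by
        ext x
        simp [mem_hitSet]
      simp [h0, this]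
    | insert y A hy ih =>
      have hle := hφ A {y} (Finset.singleton_ne_empty y)
      rw [mobiusSum_singleton] at hle
      refine ⟨by linarith, ?_⟩
      rw [hitSet_insert, measure_union (Set.disjoint_left.2 fun x hx hx' => hx'.2 hx)
        (measurableSet_missHitSet A {y}), ih.2, hα A {y} (Finset.singleton_nonempty y),
        mobiusSum_singleton, ← ENNReal.ofReal_add ih.1 (by linarith)]
      congr 1
      ring
  rw [key.2]
  exact ⟨ENNReal.ofReal_ne_top, ENNReal.toReal_ofReal key.1⟩

/-! ### Represented setfunctions -/

theorem RepresentsSetfunction.stronglySubmodular {φ : Finset J → ℝ} {α : Measure (ℕ → J)}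
    (h : RepresentsSetfunction α φ) : StronglySubmodular φ := by
  intro n hn A₀ A
  have hint : ∀ B : Finset J, Integrable ((hitSet B).indicator fun _ => (1 : ℝ)) α := fun B =>
    (integrable_indicator_iff (measurableSet_hitSet B)).2 (integrableOn_const (h B).1)
  have hφ : ∀ B : Finset J, φ B = ∫ x, (hitSet B).indicator (fun _ => (1 : ℝ)) x ∂α := by
    intro B
    rw [integral_indicator_const _ (measurableSet_hitSet B), smul_eq_mul, mul_one]
    exact (h B).2.symm
  simp only [hφ, ← integral_const_mul]
  rw [← integral_finsetSum _ fun K _ => (hint _).const_mul _]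
  refine integral_nonpos fun x => ?_
  -- Pointwise the alternating sum is minus the indicator of the sequences that miss `A₀` and hit
  -- every `A i`.
  have hind : ∀ K : Finset (Fin n), (hitSet (A₀ ∪ K.biUnion A)).indicator (fun _ => (1 : ℝ)) x
      = 1 - (hitSet A₀)ᶜ.indicator (fun _ => 1) x *
        ∏ i ∈ K, (hitSet (A i))ᶜ.indicator (fun _ => 1) x := by
    intro K
    classical
    have hprod : ∏ i ∈ K, (hitSet (A i))ᶜ.indicator (fun _ => (1 : ℝ)) x =
        if ∀ i ∈ K, x ∉ hitSet (A i) then 1 else 0 := by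
      split_ifs with h1
      · exact Finset.prod_eq_one fun i hi => Set.indicator_of_mem (h1 i hi) _
      · push Not at h1
        obtain ⟨i, hi, hx⟩ := h1
        exact Finset.prod_eq_zero hi (Set.indicator_of_notMem (not_not.2 hx) _)
    have hmem : x ∈ hitSet (A₀ ∪ K.biUnion A) ↔ x ∈ hitSet A₀ ∨ ¬ ∀ i ∈ K, x ∉ hitSet (A i) := by
      simp only [mem_hitSet, Finset.mem_union, Finset.mem_biUnion]
      grind
    rw [hprod]
    by_cases h1 : ∀ i ∈ K, x ∉ hitSet (A i)
    · rw [if_pos h1]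
      by_cases h0 : x ∈ hitSet A₀
      · rw [Set.indicator_of_mem (hmem.2 (Or.inl h0)), Set.indicator_of_notMem (not_not.2 h0)]
        ring
      · rw [Set.indicator_of_notMem fun h => (hmem.1 h).elim h0 fun h => h h1,
          Set.indicator_of_mem h0]
        ring
    · rw [if_neg h1, Set.indicator_of_mem (hmem.2 (Or.inr h1))]
      ring
  have hone : ∑ K : Finset (Fin n), (-1 : ℝ) ^ K.card = 0 := by
    have : (Finset.univ : Finset (Fin n)).Nonempty := ⟨⟨0, hn⟩, Finset.mem_univ _⟩
    have h2 := Finset.sum_powerset_neg_one_pow_card_of_nonempty this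
    rw [Finset.powerset_univ] at h2
    exact_mod_cast h2
  have hprod : ∑ K : Finset (Fin n), (-1 : ℝ) ^ K.card *
      ∏ i ∈ K, (hitSet (A i))ᶜ.indicator (fun _ => 1) x
      = ∏ i, (1 - (hitSet (A i))ᶜ.indicator (fun _ => (1 : ℝ)) x) := by
    rw [Finset.prod_sub, Finset.powerset_univ]
    simp
  calc ∑ K : Finset (Fin n), (-1 : ℝ) ^ K.card *
        (hitSet (A₀ ∪ K.biUnion A)).indicator (fun _ => (1 : ℝ)) x
      = ∑ K : Finset (Fin n), (-1 : ℝ) ^ K.card - (hitSet A₀)ᶜ.indicator (fun _ => 1) x *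
        ∑ K : Finset (Fin n), (-1 : ℝ) ^ K.card *
          ∏ i ∈ K, (hitSet (A i))ᶜ.indicator (fun _ => 1) x := by
        rw [Finset.mul_sum, ← Finset.sum_sub_distrib]
        refine Finset.sum_congr rfl fun K _ => ?_
        rw [hind K]
        ring
    _ ≤ 0 := by
        rw [hone, hprod, zero_sub, neg_nonpos]
        refine mul_nonneg (Set.indicator_nonneg (fun _ _ => zero_le_one) x)
          (Finset.prod_nonneg fun i _ => sub_nonneg.2 ?_)
        exact Set.indicator_le_self' (fun _ _ => zero_le_one) x

/-- A representing measure of a bounded setfunction may be cut down to a finite one: the sets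
`R(B n)`, with `φ (B n)` tending to the supremum of `φ`, carry almost all of every `R(A)`. The
restriction is needed because for uncountable `J` the measure obtained from a content may be
infinite on the sequences outside every countable union of sets `R(A)`. -/
theorem RepresentsSetfunction.exists_isFiniteMeasure {φ : Finset J → ℝ} {α : Measure (ℕ → J)}
    (h : RepresentsSetfunction α φ) (hb : BddAbove (Set.range φ)) :
    ∃ β : Measure (ℕ → J), IsFiniteMeasure β ∧ RepresentsSetfunction β φ := by
  have hmono : Monotone φ := fun A B hAB => by
    rw [← (h A).2, ← (h B).2]
    exact ENNReal.toReal_mono (h B).1 (measure_mono (hitSet_mono hAB))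
  have hnear : ∀ n : ℕ, ∃ A, (⨆ A, φ A) - 1 / ((n : ℝ) + 1) < φ A := fun n =>
    exists_lt_of_lt_ciSup (sub_lt_self _ Nat.one_div_pos_of_nat)
  choose C hC using hnear
  let B : ℕ → Finset J := fun n => (Finset.range (n + 1)).biUnion C
  have hB : Monotone B := fun m n hmn =>
    Finset.biUnion_subset_biUnion_of_subset_left C (Finset.range_mono (Nat.succ_le_succ hmn))
  have hCB : ∀ n, C n ⊆ B n := fun n =>
    Finset.subset_biUnion_of_mem C (Finset.mem_range.2 n.lt_succ_self)
  let N : Set (ℕ → J) := ⋃ n, hitSet (B n)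
  have hN : MeasurableSet N := MeasurableSet.iUnion fun n => measurableSet_hitSet (B n)
  have hNfin : α N ≤ ENNReal.ofReal (⨆ A, φ A) := by
    have hmonoR : Monotone fun n => hitSet (B n) := fun m n hmn => hitSet_mono (hB hmn)
    rw [hmonoR.measure_iUnion]
    refine iSup_le fun n => ?_
    rw [h.apply_eq]
    exact ENNReal.ofReal_le_ofReal (le_ciSup hb _)
  have hnull : ∀ A : Finset J, α (hitSet A \ N) = 0 := by
    intro A
    have hle : ∀ n : ℕ, α (hitSet A \ N) ≤ ENNReal.ofReal (1 / ((n : ℝ) + 1)) := by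
      intro n
      calc α (hitSet A \ N) ≤ α (hitSet (A ∪ B n) \ hitSet (B n)) :=
            measure_mono (Set.sdiff_subset_sdiff (hitSet_mono Finset.subset_union_left)
              (Set.subset_iUnion (fun n => hitSet (B n)) n))
        _ = ENNReal.ofReal (φ (A ∪ B n)) - ENNReal.ofReal (φ (B n)) := by
            rw [measure_sdiff (hitSet_mono Finset.subset_union_right)
              (measurableSet_hitSet _).nullMeasurableSet (h _).1, h.apply_eq, h.apply_eq]
        _ = ENNReal.ofReal (φ (A ∪ B n) - φ (B n)) := by
            refine (ENNReal.ofReal_sub _ ?_).symm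
            rw [← (h (B n)).2]
            exact ENNReal.toReal_nonneg
        _ ≤ ENNReal.ofReal (1 / ((n : ℝ) + 1)) := by
            refine ENNReal.ofReal_le_ofReal ?_
            have h1 := hC n
            have h2 := hmono (hCB n)
            have h3 := le_ciSup hb (A ∪ B n)
            linarith
    have hlim : Filter.Tendsto (fun n : ℕ => ENNReal.ofReal (1 / ((n : ℝ) + 1))) Filter.atTop
        (nhds 0) := by
      have := ENNReal.tendsto_ofReal (tendsto_one_div_add_atTop_nhds_zero_nat (𝕜 := ℝ))
      rwa [ENNReal.ofReal_zero] at this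
    exact le_antisymm (ge_of_tendsto' hlim hle) zero_le
  refine ⟨α.restrict N, ⟨?_⟩, fun A => ?_⟩
  · rw [Measure.restrict_apply_univ]
    exact hNfin.trans_lt ENNReal.ofReal_lt_top
  · have hA : α.restrict N (hitSet A) = α (hitSet A) := by
      rw [Measure.restrict_apply (measurableSet_hitSet A),
        ← measure_inter_add_sdiff (hitSet A) hN, hnull A, add_zero]
    rw [hA]
    exact h A

end Hypersequences

/-! ### The equivalences -/

theorem mainTheorem6 {J : Type*} [Infinite J] [DecidableEq J] (φ : Finset J → ℝ)
    (hφ : φ ∅ = 0) :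
    [StronglySubmodular φ,
      ∀ A B : Finset J, B ≠ ∅ → mobiusSum φ A B ≤ 0,
      ∃ α : @Measure (ℕ → J) (sequenceSigmaAlgebra J), RepresentsSetfunction α φ].TFAE ∧
    (BddAbove (Set.range φ) →
      [StronglySubmodular φ,
        ∀ A B : Finset J, B ≠ ∅ → mobiusSum φ A B ≤ 0,
        ∃ α : @Measure (ℕ → J) (sequenceSigmaAlgebra J),
          IsFiniteMeasure α ∧ RepresentsSetfunction α φ].TFAE) := by
  refine ⟨?_, fun hb => ?_⟩
  · tfae_have 1 → 2 := fun h A B hB => h.mobiusSum_nonpos A hB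
    tfae_have 2 → 3 := fun h => exists_representsSetfunction hφ h
    tfae_have 3 → 1 := fun ⟨_, h⟩ => h.stronglySubmodular
    tfae_finish
  · tfae_have 1 → 2 := fun h A B hB => h.mobiusSum_nonpos A hB
    tfae_have 2 → 3 := fun h =>
      have ⟨_, hα⟩ := exists_representsSetfunction hφ h
      hα.exists_isFiniteMeasure hb
    tfae_have 3 → 1 := fun ⟨_, _, h⟩ => h.stronglySubmodular
    tfae_finish
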